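/- Let $\mathcal{C}$ be a quasi-abelian category, i.e. an additive category in which every morphism has a kernel and a cokernel, kernels are closed under push-outs, and cokernels are closed under pull-backs. Endow $\mathcal{C}$ with its maximum exact structure, whose conflations are all kernel-cokernel pairs. Let $M\in\mathcal{C}$ be a generator-cogenerator: every object $X\in\mathcal{C}$ admits a deflation $N\to X$ and an inflation $X\to N'$ with $N,N'\in\operatorname{add}M$, where $\operatorname{add}M$ consists of the direct summands of finite direct sums of copies of $M$. Suppose that $\Lambda:=\operatorname{End}_{\mathcal{C}}(M)$ is left and right Noetherian. Then: 1. $\Lambda$ satisfies the two-sided $(2,2)$-condition: for $\Gamma=\Lambda$ and for $\Gamma=\Lambda^{\mathrm{op}}$, in the minimal injective resolution $0\to\Gamma\to I^0\to I^1\to\cdots$ of $\Gamma$ as a module over itself, $I^0$ and $I^1$ have flat dimension less than $2$. 2. The module $\operatorname{Hom}_{\mathcal{C}}(M,X)$, with $\Lambda$ acting by precomposition (so that it is a right module when $\Lambda$ multiplies by composition of maps), is reflexive for every $X\in\mathcal{C}$, and the functor $\operatorname{Hom}_{\mathcal{C}}(M,-)\colon\mathcal{C}\to\operatorname{refl}\Lambda$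 is an equivalence of categories. Here $\operatorname{refl}\Lambda$ is the category of reflexive $\Lambda$-modules (on that side), i.e. the full subcategory of those finitely generated modules $X$ for which the evaluation map $X\to\operatorname{Hom}_{\Lambda^{\mathrm{op}}}(\operatorname{Hom}_{\Lambda}(X,\Lambda),\Lambda)$ is an isomorphism. -/

import Mathlib

open CategoryTheory CategoryTheory.Limits
open scoped TensorProduct

universe v u w

namespace ReflMorita

noncomputable section

/-! ### Quasi-abelian categories, the maximum exact structure, generator-cogenerators -/

section Categories

variable (C : Type u) [Category.{v} C] [Preadditive C]

/-- The class of kernels: the morphisms that are a kernel of some morphism. -/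
def kernelMorphisms : MorphismProperty C := fun _ _ f => Nonempty (NormalMono f)

/-- The class of cokernels: the morphisms that are a cokernel of some morphism. -/
def cokernelMorphisms : MorphismProperty C := fun _ _ f => Nonempty (NormalEpi f)

/-- A quasi-abelian category: an additive category with kernels and cokernels, in which kernels
are closed under push-outs and cokernels are closed under pull-backs. -/
class IsQuasiAbelian : Prop extends
    HasFiniteBiproducts C, HasKernels C, HasCokernels C where
  kernels_pushout : (kernelMorphisms C).IsStableUnderCobaseChange
  cokernels_pullback : (cokernelMorphisms C).IsStableUnderBaseChange

variable {C}

/-- A kernel-cokernel pair `L ⟶ N ⟶ M`: the first map is a kernel of the second and the second is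
a cokernel of the first. In a quasi-abelian category these are the conflations of the maximum
exact structure. -/
def IsKernelCokernelPair (S : ShortComplex C) : Prop :=
  Nonempty (IsLimit (KernelFork.ofι S.f S.zero)) ∧
    Nonempty (IsColimit (CokernelCofork.ofπ S.g S.zero))

/-- Inflations (admissible monomorphisms) of the exact structure of all kernel-cokernel pairs. -/
def IsInflation {X Y : C} (f : X ⟶ Y) : Prop :=
  ∃ (Z : C) (g : Y ⟶ Z) (zero : f ≫ g = 0), IsKernelCokernelPair (ShortComplex.mk f g zero)

/-- Deflations (admissible epimorphisms) of the exact structure of all kernel-cokernel pairs. -/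
def IsDeflation {Y Z : C} (g : Y ⟶ Z) : Prop :=
  ∃ (X : C) (f : X ⟶ Y) (zero : f ≫ g = 0), IsKernelCokernelPair (ShortComplex.mk f g zero)

variable [HasFiniteBiproducts C]

attribute [local instance] hasBinaryBiproducts_of_finite_biproducts

/-- `N` belongs to `add M`: it is a direct summand of a finite direct sum of copies of `M`. -/
def MemAdd (M N : C) : Prop :=
  ∃ (n : ℕ) (N' : C), Nonempty (N ⊞ N' ≅ biproduct (fun _ : Fin n => M))

/-- Every object admits a deflation from an object of `add M`. -/
def IsGenerator (M : C) : Prop :=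
  ∀ X : C, ∃ (N : C) (g : N ⟶ X), MemAdd M N ∧ IsDeflation g

/-- Every object admits an inflation into an object of `add M`. -/
def IsCogenerator (M : C) : Prop :=
  ∀ X : C, ∃ (N : C) (f : X ⟶ N), MemAdd M N ∧ IsInflation f

/-- A generator-cogenerator for the maximum exact structure. -/
def IsGeneratorCogenerator (M : C) : Prop := IsGenerator M ∧ IsCogenerator M

end Categories

/-! ### Reflexive modules

Modules are left modules; a right `R`-module is a left module over `Rᵐᵒᵖ`. -/

section Reflexive

variable (R : Type u) [Ring R] (X : Type w) [AddCommGroup X] [Module R X]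

/-- The evaluation map `X → Hom_{Rᵒᵖ}(Hom_R(X, R), R)`. Here `Hom_R(X, R)` is a right `R`-module by
`(f r)(x) = f(x) r`, and the double dual is a left `R`-module by `(r φ)(f) = r φ(f)`. -/
def evalMap : X →ₗ[R] ((X →ₗ[R] R) →ₗ[Rᵐᵒᵖ] R) where
  toFun x :=
    { toFun := fun f => f x
      map_add' := fun _ _ => rfl
      map_smul' := fun _ _ => rfl }
  map_add' x y := by ext f; exact map_add f x y
  map_smul' r x := by ext f; exact map_smul f r x

/-- A reflexive module: finitely generated, with bijective evaluation map. -/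
def IsReflexiveModule : Prop :=
  Module.Finite R X ∧ Function.Bijective (evalMap R X)

/-- The property that cuts out the full subcategory `refl R` of all `R`-modules. -/
def reflexiveModules : ObjectProperty (ModuleCat.{u} R) := fun Y => IsReflexiveModule R Y

end Reflexive

/-! ### Flat dimension over a noncommutative ring -/

section Flat

variable (R : Type u) [Ring R]

/-- The relations `a r ⊗ m = a ⊗ r m` that define `A ⊗_R M` as a quotient of `A ⊗_ℤ M`. -/
def balancedRelations (A : Type*) [AddCommGroup A] [Module Rᵐᵒᵖ A]
    (M : Type*) [AddCommGroup M] [Module R M] : AddSubgroup (A ⊗[ℤ] M) :=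
  AddSubgroup.closure
    {t | ∃ (a : A) (r : R) (m : M), t = (MulOpposite.op r • a) ⊗ₜ[ℤ] m - a ⊗ₜ[ℤ] (r • m)}

/-- The tensor product `A ⊗_R M` of a right `R`-module `A` and a left `R`-module `M`. -/
abbrev BalancedTensor (A : Type*) [AddCommGroup A] [Module Rᵐᵒᵖ A]
    (M : Type*) [AddCommGroup M] [Module R M] : Type _ :=
  (A ⊗[ℤ] M) ⧸ balancedRelations R A M

variable {A B : Type*} [AddCommGroup A] [Module Rᵐᵒᵖ A] [AddCommGroup B] [Module Rᵐᵒᵖ B]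

/-- The map `f ⊗ M : A ⊗_R M → B ⊗_R M` induced by a map `f : A → B` of right modules. -/
def balancedMap (M : Type*) [AddCommGroup M] [Module R M] (f : A →ₗ[Rᵐᵒᵖ] B) :
    BalancedTensor R A M →+ BalancedTensor R B M :=
  QuotientAddGroup.map _ _ (LinearMap.rTensor M f.toAddMonoidHom.toIntLinearMap).toAddMonoidHom
    (by
      rw [balancedRelations, AddSubgroup.closure_le]
      rintro _ ⟨a, r, m, rfl⟩
      refine AddSubgroup.subset_closure ⟨f a, r, m, ?_⟩
      simp)

/-- A left `R`-module `M` is flat if `- ⊗_R M` preserves injectivity of maps of right modules. -/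
def IsFlatModule (M : Type*) [AddCommGroup M] [Module R M] : Prop :=
  ∀ (A B : Type u) [AddCommGroup A] [Module Rᵐᵒᵖ A] [AddCommGroup B] [Module Rᵐᵒᵖ B]
    (f : A →ₗ[Rᵐᵒᵖ] B), Function.Injective f → Function.Injective (balancedMap R M f)

/-- `FlatDimLT R l M`: the flat dimension of `M` is less than `l`, i.e. there is an exact sequence
`0 → F_{l-1} → ⋯ → F_0 → M → 0` with all `F_i` flat (for `l = 0`: `M = 0`). The sequence is built
one step at a time, through the kernel of `F_0 → M`. -/
def FlatDimLT : ℕ → ModuleCat.{u} R → Prop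
  | 0, M => Subsingleton M
  | l + 1, M => ∃ (F : ModuleCat.{u} R) (p : F →ₗ[R] M), IsFlatModule R F ∧
      Function.Surjective p ∧ FlatDimLT l (ModuleCat.of R (LinearMap.ker p))

end Flat

/-! ### Minimal injective resolutions and the `(l, n)`-condition -/

section Auslander

variable {R : Type u} [Ring R]

/-- An injective resolution `0 → X → I⁰ → I¹ → ⋯` is minimal if `Ker (Iⁱ → Iⁱ⁺¹)` is an essential
submodule of `Iⁱ` for every `i`; that is, `I⁰` is an injective hull of `X`, and `Iⁱ` is an injective
hull of the image of `Iⁱ⁻¹` for `i ≥ 1`. -/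
def IsMinimalResolution {X : ModuleCat.{u} R} (I : InjectiveResolution X) : Prop :=
  ∀ (i : ℕ) (N : Submodule R (I.cocomplex.X i)),
    N ⊓ LinearMap.ker (I.cocomplex.d i (i + 1)).hom = ⊥ → N = ⊥

variable (R)

/-- The `(l, n)`-condition: in the minimal injective resolution `0 → R → I⁰ → I¹ → ⋯` of the left
`R`-module `R`, the flat dimension of `Iⁱ` is less than `l` for all `0 ≤ i < n`. (The minimal
injective resolution exists, and it is unique up to isomorphism.) -/
def SatisfiesCondition (l n : ℕ) : Prop :=
  ∀ I : InjectiveResolution (ModuleCat.of R R), IsMinimalResolution I →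
    ∀ i < n, FlatDimLT R l (I.cocomplex.X i)

/-- The two-sided `(l, n)`-condition. -/
def SatisfiesTwoSidedCondition (l n : ℕ) : Prop :=
  SatisfiesCondition R l n ∧ SatisfiesCondition Rᵐᵒᵖ l n

end Auslander

end

end ReflMorita

/-! The engine is that `Hom(M, -)` is fully faithful (`IsNormalGenerator.existsUnique_comp`), and
dually that `Hom(-, M)` is.

For the `(2, 2)`-condition, consider for each kernel `j` out of `M` the left ideal `𝔞` of
endomorphisms factoring through `j`. Then `Hom(Λ/𝔞, Λ) = Ext¹(Λ/𝔞, Λ) = 0`, because `j` is a kernel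
and `Hom(-, M)` is fully faithful. Moreover `Ext²(X, Λ)` is torsion for these ideals for every
finitely presented right module `X`: a class in it is represented by a morphism from a kernel to
`M`, and pushing the kernel out along this morphism yields the annihilating `𝔞`
(`isDenseFamily_factorIdeal`). The two vanishings make `I⁰` and `I¹` torsion-free. For an injective
torsion-free `I`, `Tor₂(X, I) ≅ Hom(Ext²(X, Λ), I) = 0`, so `I` has flat dimension at most one
(`flatDimLT_two`). This is carried out with matrices and the equational criterion
`isFlatModule_of_hasTrivialRelations`. The other side follows by passing to the opposite category.

For the equivalence, the two full faithfulness statements identify the dual of `Hom(M, X)` with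
`Hom(X, M)` and the dual of that with `Hom(M, X)`. Conversely, dualizing a presentation of the dual
of a reflexive module exhibits the module as the kernel of a matrix
(`exists_linearMap_of_isReflexiveModule`); the kernel in `C` of the same matrix, read as a map
between powers of `M`, is a preimage. -/

namespace ReflMorita

noncomputable section

/-! ### The equational criterion for flatness over a noncommutative ring -/

section EquationalCriterion

variable (R : Type u) [Ring R] (K : Type w) [AddCommGroup K] [Module R K]

/-- The equational criterion for flatness: every finite system of linear relations between elements
of `K` is a consequence of relations in `R`. -/
def HasTrivialRelations : Prop :=
  ∀ {I J : Type} [Fintype I] [Fintype J] (r : Matrix I J R) (k : J → K),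
    (∀ i, ∑ j, r i j • k j = 0) →
      ∃ (L : Type) (_ : Fintype L) (S : Matrix J L R) (k' : L → K),
        (∀ j, k j = ∑ l, S j l • k' l) ∧ ∀ i l, ∑ j, r i j * S j l = 0

variable (A : Type*) [AddCommGroup A] [Module Rᵐᵒᵖ A]
variable {B : Type*} [AddCommGroup B] [Module Rᵐᵒᵖ B]

/-- The map from the free right module on the set `A` to the right module `A`. -/
def totalMap : (A →₀ R) →ₗ[Rᵐᵒᵖ] A :=
  Finsupp.lsum ℕ fun a =>
    { toFun := fun r => MulOpposite.op r • a
      map_add' := fun r s => by simp [add_smul]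
      map_smul' := fun c r => by simp [mul_smul] }

@[simp]
theorem totalMap_single (a : A) (r : R) :
    totalMap R A (Finsupp.single a r) = MulOpposite.op r • a := by
  simp [totalMap]

theorem totalMap_mapDomain (f : A →ₗ[Rᵐᵒᵖ] B) (s : A →₀ R) :
    totalMap R B (s.mapDomain f) = f (totalMap R A s) := by
  induction s using Finsupp.induction_linear with
  | zero => simp
  | add s t hs ht => simp [Finsupp.mapDomain_add, hs, ht]
  | single a r => simp

/-- The map `(a ↦ k a) ↦ ∑ a ⊗ k a`. -/
def sumTmul : (A →₀ K) →+ A ⊗[ℤ] K :=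
  Finsupp.liftAddHom fun a => (TensorProduct.mk ℤ A K a).toAddMonoidHom

@[simp]
theorem sumTmul_single (a : A) (k : K) : sumTmul K A (Finsupp.single a k) = a ⊗ₜ k := by
  simp [sumTmul]

theorem sumTmul_surjective : Function.Surjective (sumTmul K A) := by
  intro t
  induction t with
  | zero => exact ⟨0, map_zero _⟩
  | tmul a k => exact ⟨Finsupp.single a k, by simp⟩
  | add x y hx hy =>
    obtain ⟨zx, rfl⟩ := hx
    obtain ⟨zy, rfl⟩ := hy
    exact ⟨zx + zy, map_add _ _ _⟩

/-- The subgroup of finitely supported functions `A → K` generated by the `s • k`, where `s` is a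
relation between the elements of the right module `A`. -/
def relationSubgroup : AddSubgroup (A →₀ K) :=
  AddSubgroup.closure
    {z | ∃ (s : A →₀ R) (k : K), totalMap R A s = 0 ∧ z = s.mapRange (· • k) (zero_smul R k)}

variable {R K A}

theorem exists_of_mem_relationSubgroup {z : A →₀ K} (hz : z ∈ relationSubgroup R K A) :
    ∃ (J : Type) (_ : Fintype J) (s : J → A →₀ R) (k : J → K),
      (∀ j, totalMap R A (s j) = 0) ∧ ∀ a, z a = ∑ j, s j a • k j := by
  induction hz using AddSubgroup.closure_induction with
  | mem z hz =>
    obtain ⟨s, k, hs, rfl⟩ := hz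
    exact ⟨Unit, inferInstance, fun _ => s, fun _ => k, fun _ => hs, by simp⟩
  | zero => exact ⟨Empty, inferInstance, Empty.elim, Empty.elim, nofun, by simp⟩
  | add x y _ _ hx hy =>
    obtain ⟨J, _, s, k, hs, hx⟩ := hx
    obtain ⟨J', _, s', k', hs', hy⟩ := hy
    refine ⟨J ⊕ J', inferInstance, Sum.elim s s', Sum.elim k k', ?_, ?_⟩
    · rintro (j | j)
      · exact hs j
      · exact hs' j
    · simp [hx, hy]
  | neg x _ hx =>
    obtain ⟨J, _, s, k, hs, hx⟩ := hx
    exact ⟨J, inferInstance, s, fun j => -k j, hs, by simp [hx]⟩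

theorem mem_relationSubgroup {J : Type} [Fintype J] {z : A →₀ K} (s : J → A →₀ R) (k : J → K)
    (hs : ∀ j, totalMap R A (s j) = 0) (hz : ∀ a, z a = ∑ j, s j a • k j) :
    z ∈ relationSubgroup R K A := by
  have : z = ∑ j, (s j).mapRange (· • k j) (zero_smul R (k j)) := by
    ext a
    simp [hz, Finsupp.finsetSum_apply]
  rw [this]
  exact sum_mem fun j _ => AddSubgroup.subset_closure ⟨s j, k j, hs j, rfl⟩

theorem sumTmul_mem_balancedRelations {z : A →₀ K} (hz : z ∈ relationSubgroup R K A) :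
    sumTmul K A z ∈ balancedRelations R A K := by
  -- Modulo balanced relations, scalars move across the tensor sign, so `(∑ a s(a)) ⊗ k` equals `∑ a
  -- ⊗ s(a) k`.
  have key : ∀ (s : A →₀ R) (k : K), totalMap R A s ⊗ₜ[ℤ] k -
      sumTmul K A (s.mapRange (· • k) (zero_smul R k)) ∈ balancedRelations R A K := by
    intro s k
    induction s using Finsupp.induction_linear with
    | zero => simp
    | add s t hs ht =>
      rw [Finsupp.mapRange_add (fun x y => add_smul x y k), map_add, map_add, TensorProduct.add_tmul,
        add_sub_add_comm]
      exact add_mem hs ht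
    | single a r =>
      rw [Finsupp.mapRange_single, sumTmul_single, totalMap_single]
      exact AddSubgroup.subset_closure ⟨a, r, k, rfl⟩
  refine (AddSubgroup.closure_le (K := (balancedRelations R A K).comap (sumTmul K A))).2 ?_ hz
  rintro _ ⟨s, k, hs, rfl⟩
  have := key s k
  rw [hs, TensorProduct.zero_tmul, zero_sub, neg_mem_iff] at this
  exact this

variable (R K A) in
/-- The biadditive map `(a, k) ↦ [single a k]`. -/
def tensorToRelationQuotient : A ⊗[ℤ] K →+ (A →₀ K) ⧸ relationSubgroup R K A :=
  TensorProduct.liftAddHom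
    (AddMonoidHom.mk' (fun a => (QuotientAddGroup.mk' (relationSubgroup R K A)).comp
      (Finsupp.singleAddHom a)) (by
        intro a a'
        ext k
        simp only [AddMonoidHom.comp_apply, AddMonoidHom.add_apply, QuotientAddGroup.mk'_apply,
          Finsupp.singleAddHom_apply]
        rw [← QuotientAddGroup.mk_add, QuotientAddGroup.eq]
        -- Additivity in the first variable comes from the relation `[a] + [a'] - [a + a']` among
        -- elements of `A`.
        refine AddSubgroup.subset_closure
          ⟨-Finsupp.single (a + a') 1 + (Finsupp.single a 1 + Finsupp.single a' 1), k, ?_, ?_⟩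
        · simp only [map_add, map_neg, totalMap_single, MulOpposite.op_one, one_smul]
          abel
        · classical
          ext c
          simp [Finsupp.single_apply, add_smul, ite_smul]))
    (by
      intro n a k
      rw [map_zsmul, map_zsmul, AddMonoidHom.zsmul_apply])

theorem tensorToRelationQuotient_sumTmul (z : A →₀ K) :
    tensorToRelationQuotient R K A (sumTmul K A z) = QuotientAddGroup.mk z := by
  induction z using Finsupp.induction_linear with
  | zero => simp
  | add s t hs ht => simp [hs, ht]
  | single a r => simp [tensorToRelationQuotient]

theorem balancedRelations_le_ker :
    balancedRelations R A K ≤ (tensorToRelationQuotient R K A).ker := by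
  rw [balancedRelations, AddSubgroup.closure_le]
  rintro _ ⟨a, r, k, rfl⟩
  rw [SetLike.mem_coe, AddMonoidHom.mem_ker, ← sumTmul_single, ← sumTmul_single, ← map_sub,
    tensorToRelationQuotient_sumTmul, QuotientAddGroup.eq_zero_iff]
  refine AddSubgroup.subset_closure
    ⟨Finsupp.single (MulOpposite.op r • a) 1 - Finsupp.single a r, k, by simp, ?_⟩
  classical
  ext c
  simp [Finsupp.single_apply, sub_smul, ite_smul]

/-- This presents `A ⊗_R K` as a quotient of `A →₀ K`, where vanishing of an element is witnessed by
finitely many relations in `A`. -/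
theorem sumTmul_mem_balancedRelations_iff {z : A →₀ K} :
    sumTmul K A z ∈ balancedRelations R A K ↔ z ∈ relationSubgroup R K A := by
  refine ⟨fun h => ?_, sumTmul_mem_balancedRelations⟩
  have := balancedRelations_le_ker h
  rwa [AddMonoidHom.mem_ker, tensorToRelationQuotient_sumTmul,
    QuotientAddGroup.eq_zero_iff] at this

/-- If an element dies in `B ⊗ K`, relations `s j` in `B` witness this. Their coefficients outside
the image of `A` give linear relations among the `k j`. Trivializing these replaces the `s j` by
combinations supported on the image, which pull back to relations in `A`. -/
theorem isFlatModule_of_hasTrivialRelations (h : HasTrivialRelations R K) : IsFlatModule R K := by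
  intro A B _ _ _ _ f hf
  rw [injective_iff_map_eq_zero]
  intro x hx
  obtain ⟨t, rfl⟩ := QuotientAddGroup.mk_surjective x
  obtain ⟨z, rfl⟩ := sumTmul_surjective K A t
  have hmap : ∀ z : A →₀ K, LinearMap.rTensor K f.toAddMonoidHom.toIntLinearMap (sumTmul K A z) =
      sumTmul K B (z.mapDomain f) := by
    intro z
    induction z using Finsupp.induction_linear with
    | zero => simp
    | add s t hs ht => rw [map_add, map_add, hs, ht, Finsupp.mapDomain_add, map_add]
    | single a r => simp
  have hz : z.mapDomain f ∈ relationSubgroup R K B := by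
    rw [← sumTmul_mem_balancedRelations_iff, ← hmap]
    exact (QuotientAddGroup.eq_zero_iff _).1 hx
  obtain ⟨J, _, s, k, hs, hk⟩ := exists_of_mem_relationSubgroup hz
  classical
  -- Only finitely many points outside the image matter; they are numbered by `Fin` to give an index
  -- type in `Type`.
  let E : Finset B := (Finset.univ.biUnion fun j => (s j).support).filter fun b => b ∉ Set.range f
  obtain ⟨L, _, S, k', hS, hr⟩ := h
    (fun (i : Fin E.card) j => s j (E.equivFin.symm i : B)) k (by
      intro i
      rw [← hk, Finsupp.mapDomain_of_notMem_range]
      exact (Finset.mem_filter.1 (E.equivFin.symm i).2).2)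
  let s' : L → B →₀ R := fun l => ∑ j, MulOpposite.op (S j l) • s j
  have hs' : ∀ l b, s' l b = ∑ j, s j b * S j l := fun l b => by
    simp [s', Finsupp.finsetSum_apply]
  have hzero : ∀ b, b ∉ Set.range f → ∀ l, s' l b = 0 := by
    intro b hb l
    rw [hs']
    by_cases hE : b ∈ E
    · simpa using hr (E.equivFin ⟨b, hE⟩) l
    · refine Finset.sum_eq_zero fun j _ => ?_
      have : s j b = 0 := by
        by_contra hne
        exact hE (Finset.mem_filter.2 ⟨Finset.mem_biUnion.2 ⟨j, Finset.mem_univ _,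
          Finsupp.mem_support_iff.2 hne⟩, hb⟩)
      rw [this, zero_mul]
  refine (QuotientAddGroup.eq_zero_iff _).2 (sumTmul_mem_balancedRelations
    (mem_relationSubgroup (fun l => (s' l).comapDomain f hf.injOn) k' (fun l => ?_) fun a => ?_))
  · apply hf
    rw [← totalMap_mapDomain, Finsupp.mapDomain_comapDomain f hf, map_zero]
    · simp [s', hs]
    · intro b hb
      by_contra hne
      exact Finsupp.mem_support_iff.1 hb (hzero b hne l)
  · rw [← Finsupp.mapDomain_apply hf z a, hk]
    simp only [Finsupp.comapDomain_apply, hs', Finset.sum_smul, mul_smul]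
    rw [Finset.sum_comm]
    exact Finset.sum_congr rfl fun j _ => by rw [← Finset.smul_sum, ← hS]

end EquationalCriterion

/-! ### Dense families of left ideals and the `(2, 2)`-condition -/

/-! ### Matrices over a right Noetherian ring -/

section Noetherian

instance isNoetherian_op_self (R : Type*) [Ring R] [IsNoetherianRing Rᵐᵒᵖ] :
    IsNoetherian Rᵐᵒᵖ R :=
  isNoetherian_of_linearEquiv
    ({ toFun := MulOpposite.unop
       invFun := MulOpposite.op
       map_add' := fun _ _ => rfl
       map_smul' := fun _ _ => rfl
       left_inv := fun _ => rfl
       right_inv := fun _ => rfl } : Rᵐᵒᵖ ≃ₗ[Rᵐᵒᵖ] R)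

variable {R : Type*} [Ring R] {I J L : Type} [Fintype J] [Fintype L]

theorem exists_matrix_of_submodule [IsNoetherianRing Rᵐᵒᵖ] (N : Submodule Rᵐᵒᵖ (J → R)) :
    ∃ (n : ℕ) (T : Matrix J (Fin n) R), ∀ v, v ∈ N ↔ ∃ u, T.mulVec u = v := by
  obtain ⟨n, t, rfl⟩ := Submodule.fg_iff_exists_fin_generating_family.1
    (IsNoetherian.noetherian N)
  have h : ∀ c : Fin n → R, Matrix.mulVec (fun j l => t l j) c = ∑ l, MulOpposite.op (c l) • t l :=
    fun c => by
      ext j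
      simp [Matrix.mulVec, dotProduct]
  refine ⟨n, fun j l => t l j, fun v => ?_⟩
  rw [Submodule.mem_span_range_iff_exists_fun]
  refine ⟨fun ⟨c, hc⟩ => ⟨fun l => (c l).unop, ?_⟩, fun ⟨u, hu⟩ => ⟨fun l => .op (u l), ?_⟩⟩
  · rw [h, ← hc]
    rfl
  · rw [← hu, h]

/-- Over a right Noetherian ring every matrix is the second map of an exact sequence of free right
modules of finite rank. -/
theorem exists_exact_matrix [IsNoetherianRing Rᵐᵒᵖ] (r : Matrix I J R) :
    ∃ (n : ℕ) (T : Matrix J (Fin n) R), ∀ v, r.mulVec v = 0 ↔ ∃ u, T.mulVec u = v :=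
  exists_matrix_of_submodule
    { carrier := {v | r.mulVec v = 0}
      add_mem' := fun {v w} hv hw => by
        rw [Set.mem_ofPred_eq] at *
        rw [Matrix.mulVec_add, hv, hw, add_zero]
      zero_mem' := Matrix.mulVec_zero r
      smul_mem' := fun c v hv => by
        rw [Set.mem_ofPred_eq] at *
        rw [Matrix.mulVec_smul, hv, smul_zero] }

theorem sum_mul_eq_zero_of_exact {r : Matrix I J R} {T : Matrix J L R}
    (h : ∀ v, r.mulVec v = 0 ↔ ∃ u, T.mulVec u = v) (i : I) (l : L) :
    ∑ j, r i j * T j l = 0 := by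
  classical
  exact congrFun ((h (fun j => T j l)).2 ⟨Pi.single l 1, by ext; simp⟩) i

end Noetherian

variable {R : Type u} [Ring R]

/-- A family of left ideals `𝔞` such that `Hom(R/𝔞, R) = Ext¹(R/𝔞, R) = 0`, closed under passing to
cyclic submodules of `R/𝔞`, and such that `Ext²(X, R)` consists of elements annihilated by members
of the family, for all finitely presented right modules `X`. -/
structure IsDenseFamily (𝒟 : Set (Ideal R)) : Prop where
  colon : ∀ 𝔞 ∈ 𝒟, ∀ a : R, ∃ 𝔟 ∈ 𝒟, ∀ x ∈ 𝔟, x * a ∈ 𝔞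
  existsUnique_mul : ∀ 𝔞 ∈ 𝒟, ∀ φ : 𝔞 →ₗ[R] R, ∃! t, ∀ x : 𝔞, φ x = x * t
  exists_mul_mem : ∀ {I J L : Type} [Fintype I] [Fintype J] [Fintype L] (r : Matrix I J R)
    (T : Matrix J L R), (∀ v, r.mulVec v = 0 ↔ ∃ u, T.mulVec u = v) →
    ∀ w : L → R, (∀ u, T.mulVec u = 0 → ∑ l, w l * u l = 0) →
      ∃ 𝔞 ∈ 𝒟, ∀ x ∈ 𝔞, ∃ y : J → R, ∀ l, x * w l = ∑ j, y j * T j l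

/-- No nonzero element of `I` is annihilated by a member of `𝒟`. -/
def IsTorsionFreeFor (𝒟 : Set (Ideal R)) (I : Type*) [AddCommGroup I] [Module R I] : Prop :=
  ∀ 𝔞 ∈ 𝒟, ∀ y : I, (∀ x ∈ 𝔞, x • y = 0) → y = 0

variable {𝒟 : Set (Ideal R)}

/-- The sequence `Iᴹ → Iᴸ → Iᴶ` is exact. -/
theorem exists_eq_sum_smul (h𝒟 : IsDenseFamily 𝒟) {E : Type u} [AddCommGroup E] [Module R E]
    (hE : Module.Injective R E) (ht : IsTorsionFreeFor 𝒟 E) {I J L M : Type} [Fintype I]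
    [Fintype J] [Fintype L] [Fintype M] {r : Matrix I J R} {T : Matrix J L R} {U : Matrix L M R}
    (hr : ∀ v, r.mulVec v = 0 ↔ ∃ u, T.mulVec u = v)
    (hT : ∀ v, T.mulVec v = 0 ↔ ∃ u, U.mulVec u = v)
    (x : L → E) (hx : ∀ j, ∑ l, T j l • x l = 0) :
    ∃ z : M → E, ∀ l, x l = ∑ m, U l m • z m := by
  classical
  let φ : (L → R) →ₗ[R] E := Fintype.linearCombination R x
  let g : (L → R) →ₗ[R] (M → R) := U.vecMulLinear
  have hφ : ∀ v, φ v = ∑ l, v l • x l := fun v => Fintype.linearCombination_apply R x v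
  -- A row `w` with `w U = 0` is a cocycle for `Ext²(coker r, R)`. Some `𝔞` carries it into the row
  -- space of `T`, on which `φ` vanishes by `hx`; torsion-freeness of `E` then gives `φ w = 0`.
  have hg : LinearMap.ker g ≤ LinearMap.ker φ := by
    intro w hw
    have hw' : Matrix.vecMul w U = 0 := hw
    obtain ⟨𝔞, h𝔞, h⟩ := h𝒟.exists_mul_mem r T hr w fun u hu => by
      obtain ⟨s, rfl⟩ := (hT u).1 hu
      change w ⬝ᵥ U.mulVec s = 0
      rw [Matrix.dotProduct_mulVec, hw', zero_dotProduct]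
    refine ht 𝔞 h𝔞 _ fun a ha => ?_
    obtain ⟨y, hy⟩ := h a ha
    rw [hφ, Finset.smul_sum]
    simp only [smul_smul, hy, Finset.sum_smul]
    rw [Finset.sum_comm]
    refine Finset.sum_eq_zero fun j _ => ?_
    simp only [mul_smul, ← Finset.smul_sum, hx, smul_zero]
  -- Injectivity extends the map induced by `φ` on the image of `g` to all of `M → R`; the values of
  -- `ψ` on the standard basis are the desired `z`.
  obtain ⟨ψ, hψ⟩ := hE.out ((LinearMap.ker g).liftQ g le_rfl)
    (LinearMap.ker_eq_bot.1 (Submodule.ker_liftQ_eq_bot _ _ _ le_rfl))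
    ((LinearMap.ker g).liftQ φ hg)
  have hψ' : ∀ v, ψ (g v) = φ v := fun v => by
    simpa using hψ (Submodule.Quotient.mk v)
  refine ⟨fun m => ψ (Pi.single m 1), fun l => ?_⟩
  have h1 : φ (Pi.single l 1) = x l := by simp [φ]
  rw [← h1, ← hψ']
  have h2 : g (Pi.single l 1) = U l := by
    ext m
    simp [g]
  rw [h2]
  exact (congrArg ψ (pi_eq_sum_univ' (U l))).trans (by simp only [map_sum, map_smul])

theorem exists_finsupp_eq_sum_smul {ι : Type*} [IsNoetherianRing Rᵐᵒᵖ] {I J L : Type} [Fintype I]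
    [Fintype J] [Fintype L] {r : Matrix I J R} {T : Matrix J L R}
    (hr : ∀ v, r.mulVec v = 0 ↔ ∃ u, T.mulVec u = v)
    (k : J → ι →₀ R) (hk : ∀ i, ∑ j, r i j • k j = 0) :
    ∃ f : L → ι →₀ R, ∀ j, k j = ∑ l, T j l • f l := by
  -- The system is solved coordinatewise; choosing `0` where all `k j i` vanish keeps the solution
  -- finitely supported.
  have h : ∀ i, ∃ u : L → R, T.mulVec u = (fun j => k j i) ∧ ((∀ j, k j i = 0) → u = 0) := by
    intro i
    by_cases h0 : ∀ j, k j i = 0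
    · exact ⟨0, by ext j; simp [h0], fun _ => rfl⟩
    · obtain ⟨u, hu⟩ := (hr fun j => k j i).1 (by
        ext i'
        simpa [Matrix.mulVec, dotProduct, Finsupp.finsetSum_apply] using
          DFunLike.congr_fun (hk i') i)
      exact ⟨u, hu, fun h => absurd h h0⟩
  choose u hu hu0 using h
  classical
  refine ⟨fun l => Finsupp.onFinset (Finset.univ.biUnion fun j => (k j).support) (fun i => u i l)
    fun i hi => ?_, fun j => ?_⟩
  · by_contra hmem
    simp only [Finset.mem_biUnion, Finset.mem_univ, true_and, not_exists,
      Finsupp.notMem_support_iff] at hmem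
    exact hi (by rw [hu0 i hmem, Pi.zero_apply])
  · ext i
    simpa [Matrix.mulVec, dotProduct, Finsupp.finsetSum_apply] using (congrFun (hu i) j).symm

theorem hasTrivialRelations_finsupp [IsNoetherianRing Rᵐᵒᵖ] (ι : Type*) :
    HasTrivialRelations R (ι →₀ R) := by
  intro I J _ _ r k hk
  obtain ⟨L, T, hT⟩ := exists_exact_matrix r
  obtain ⟨f, hf⟩ := exists_finsupp_eq_sum_smul hT k hk
  exact ⟨Fin L, inferInstance, T, f, hf, sum_mul_eq_zero_of_exact hT⟩

/-- This is `Tor₁(X, ker p) = Tor₂(X, E) = 0`. A solution `k = T f` in the free module has `p f`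
killed by `T`, so `p f = U z`. Subtracting `U ζ` with `ζ` lifting `z` moves `f` into `ker p` and
leaves `k` unchanged, since `T U = 0`. -/
theorem hasTrivialRelations_ker [IsNoetherianRing Rᵐᵒᵖ] (h𝒟 : IsDenseFamily 𝒟) {E : Type u}
    [AddCommGroup E] [Module R E] (hE : Module.Injective R E) (ht : IsTorsionFreeFor 𝒟 E)
    {ι : Type*} (p : (ι →₀ R) →ₗ[R] E) (hp : Function.Surjective p) :
    HasTrivialRelations R (LinearMap.ker p) := by
  intro I J _ _ r k hk
  obtain ⟨L, T, hT⟩ := exists_exact_matrix r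
  obtain ⟨M, U, hU⟩ := exists_exact_matrix T
  obtain ⟨f, hf⟩ := exists_finsupp_eq_sum_smul hT (fun j => (k j : ι →₀ R)) fun i => by
    simpa using congrArg Subtype.val (hk i)
  obtain ⟨z, hz⟩ := exists_eq_sum_smul h𝒟 hE ht hT hU (fun l => p (f l)) fun j => by
    have := (k j).2
    rw [hf] at this
    simpa using this
  choose ζ hζ using fun m => hp (z m)
  refine ⟨Fin L, inferInstance, T, fun l => ⟨f l - ∑ m, U l m • ζ m, ?_⟩, fun j => ?_,
    sum_mul_eq_zero_of_exact hT⟩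
  · simp [hζ, hz]
  · apply Subtype.ext
    rw [hf]
    simp only [AddSubmonoidClass.coe_finsetSum, SetLike.val_smul, smul_sub,
      Finset.sum_sub_distrib]
    rw [eq_comm, sub_eq_self]
    simp only [Finset.smul_sum, smul_smul]
    rw [Finset.sum_comm]
    exact Finset.sum_eq_zero fun m _ => by
      rw [← Finset.sum_smul, sum_mul_eq_zero_of_exact hU, zero_smul]

theorem flatDimLT_two [IsNoetherianRing Rᵐᵒᵖ] (h𝒟 : IsDenseFamily 𝒟) (E : ModuleCat.{u} R)
    (hE : Module.Injective R E) (ht : IsTorsionFreeFor 𝒟 E) : FlatDimLT R 2 E := by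
  let p : (E →₀ R) →ₗ[R] E := Finsupp.linearCombination R id
  have hp : Function.Surjective p := Finsupp.linearCombination_id_surjective R E
  refine ⟨ModuleCat.of R (E →₀ R), p,
    isFlatModule_of_hasTrivialRelations (hasTrivialRelations_finsupp E), hp,
    ModuleCat.of R (LinearMap.ker p), LinearMap.id,
    isFlatModule_of_hasTrivialRelations (hasTrivialRelations_ker h𝒟 hE ht p hp),
    Function.surjective_id, ?_⟩
  change Subsingleton (LinearMap.ker LinearMap.id)
  rw [LinearMap.ker_id]
  infer_instance

/-! ### Torsion-freeness along a minimal injective resolution -/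

section Resolution

variable {E₀ E₁ : Type*} [AddCommGroup E₀] [Module R E₀] [AddCommGroup E₁] [Module R E₁]

/-- A nonzero torsion element would have a nonzero multiple in `N`, and closure under colon ideals
makes that multiple torsion as well. -/
theorem isTorsionFreeFor_of_essential (h𝒟 : IsDenseFamily 𝒟) (N : Submodule R E₀)
    (hess : ∀ N' : Submodule R E₀, N' ⊓ N = ⊥ → N' = ⊥)
    (hN : ∀ 𝔞 ∈ 𝒟, ∀ y ∈ N, (∀ x ∈ 𝔞, x • y = 0) → y = 0) : IsTorsionFreeFor 𝒟 E₀ := by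
  intro 𝔞 h𝔞 y hy
  rw [← Submodule.span_singleton_eq_bot (R := R)]
  refine hess _ ((Submodule.eq_bot_iff _).2 ?_)
  rintro z ⟨hz, hzN⟩
  obtain ⟨a, rfl⟩ := Submodule.mem_span_singleton.1 hz
  obtain ⟨𝔟, h𝔟, h⟩ := h𝒟.colon 𝔞 h𝔞 a
  exact hN 𝔟 h𝔟 _ hzN fun x hx => by rw [smul_smul, hy _ (h x hx)]

theorem isTorsionFreeFor_self (h𝒟 : IsDenseFamily 𝒟) : IsTorsionFreeFor 𝒟 R := by
  intro 𝔞 h𝔞 y hy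
  -- Right multiplications by `y` and by `0` both restrict to the zero map on `𝔞`.
  exact (h𝒟.existsUnique_mul 𝔞 h𝔞 0).unique (fun x => (hy x x.2).symm) fun x => by simp

theorem isTorsionFreeFor_range (h𝒟 : IsDenseFamily 𝒟) (ι : R →ₗ[R] E₀)
    (hι : Function.Injective ι) (ht : IsTorsionFreeFor 𝒟 E₀) (d : E₀ →ₗ[R] E₁)
    (hd : LinearMap.ker d = LinearMap.range ι) :
    ∀ 𝔞 ∈ 𝒟, ∀ y ∈ LinearMap.range d, (∀ x ∈ 𝔞, x • y = 0) → y = 0 := by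
  rintro 𝔞 h𝔞 _ ⟨y, rfl⟩ hy
  have hmem : ∀ x : 𝔞, (x : R) • y ∈ LinearMap.range ι := fun x => by
    rw [← hd, LinearMap.mem_ker, map_smul, hy x x.2]
  let φ : 𝔞 →ₗ[R] R := (LinearEquiv.ofInjective ι hι).symm.toLinearMap ∘ₗ
    ((LinearMap.toSpanSingleton R E₀ y).comp 𝔞.subtype).codRestrict (LinearMap.range ι) hmem
  have hφ : ∀ x : 𝔞, ι (φ x) = (x : R) • y := fun x => by
    have := LinearEquiv.apply_symm_apply (LinearEquiv.ofInjective ι hι) ⟨(x : R) • y, hmem x⟩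
    exact congrArg Subtype.val this
  obtain ⟨t, h, -⟩ := h𝒟.existsUnique_mul 𝔞 h𝔞 φ
  have : y - ι t = 0 := ht 𝔞 h𝔞 _ fun x hx => by
    rw [smul_sub, ← hφ ⟨x, hx⟩, h, ← map_smul, smul_eq_mul, sub_self]
  rw [sub_eq_zero.1 this]
  exact (LinearMap.mem_ker).1 (hd ▸ LinearMap.mem_range_self ι t)

end Resolution

theorem satisfiesCondition_of_isDenseFamily [IsNoetherianRing Rᵐᵒᵖ] (h𝒟 : IsDenseFamily 𝒟) :
    SatisfiesCondition R 2 2 := by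
  intro X hX i hi
  let ι : R →ₗ[R] X.cocomplex.X 0 := (X.ι.f 0).hom
  have hι : Function.Injective ι := (ModuleCat.mono_iff_injective (X.ι.f 0)).1 inferInstance
  have h0 : LinearMap.ker (X.cocomplex.d 0 1).hom = LinearMap.range ι :=
    ((ShortComplex.moduleCat_exact_iff_range_eq_ker _).1 X.exact₀).symm
  have h1 : LinearMap.ker (X.cocomplex.d 1 2).hom = LinearMap.range (X.cocomplex.d 0 1).hom :=
    ((ShortComplex.moduleCat_exact_iff_range_eq_ker _).1 (X.exact_succ 0)).symm
  have ht0 : IsTorsionFreeFor 𝒟 (X.cocomplex.X 0) := by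
    refine isTorsionFreeFor_of_essential h𝒟 _ (hX 0) ?_
    rw [h0]
    rintro 𝔞 h𝔞 _ ⟨y, rfl⟩ hy
    rw [isTorsionFreeFor_self h𝒟 𝔞 h𝔞 y fun x hx => hι (by rw [map_smul, hy x hx, map_zero]),
      map_zero]
  have ht1 : IsTorsionFreeFor 𝒟 (X.cocomplex.X 1) := by
    refine isTorsionFreeFor_of_essential h𝒟 _ (hX 1) ?_
    rw [h1]
    exact isTorsionFreeFor_range h𝒟 ι hι ht0 _ h0
  have hinj : ∀ i, Module.Injective R (X.cocomplex.X i) := fun i =>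
    have : Injective (ModuleCat.of R (X.cocomplex.X i)) := X.injective i
    Module.injective_module_of_injective_object R _
  interval_cases i
  · exact flatDimLT_two h𝒟 _ (hinj 0) ht0
  · exact flatDimLT_two h𝒟 _ (hinj 1) ht1

/-! ### Morphisms out of a generator -/

section Generator

variable {C : Type u} [Category.{v} C] [Preadditive C]

/-- The identity of `N` factors through a finite direct sum of copies of `M`. -/
def IsSummand (M N : C) : Prop :=
  ∃ (n : ℕ) (a : Fin n → (N ⟶ M)) (b : Fin n → (M ⟶ N)), ∑ i, a i ≫ b i = 𝟙 N

/-- Every object is a cokernel of some morphism to a summand of a power of `M`. -/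
def IsNormalGenerator (M : C) : Prop :=
  ∀ X : C, ∃ (N : C) (g : N ⟶ X), IsSummand M N ∧ Nonempty (NormalEpi g)

/-- Every object is a kernel of some morphism from a summand of a power of `M`. -/
def IsNormalCogenerator (M : C) : Prop :=
  ∀ X : C, ∃ (N : C) (f : X ⟶ N), IsSummand M N ∧ Nonempty (NormalMono f)

theorem IsSummand.op {M N : C} (h : IsSummand M N) :
    IsSummand (Opposite.op M) (Opposite.op N) := by
  obtain ⟨n, a, b, hab⟩ := h
  refine ⟨n, fun i => (b i).op, fun i => (a i).op, ?_⟩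
  rw [← op_id, ← hab, op_sum]
  rfl

theorem IsNormalGenerator.op {M : C} (h : IsNormalGenerator M) :
    IsNormalCogenerator (Opposite.op M) := fun X =>
  let ⟨_, g, hN, ⟨hg⟩⟩ := h X.unop
  ⟨_, g.op, hN.op, ⟨normalMonoOfNormalEpiUnop g.op hg⟩⟩

theorem IsNormalCogenerator.op {M : C} (h : IsNormalCogenerator M) :
    IsNormalGenerator (Opposite.op M) := fun X =>
  let ⟨_, f, hN, ⟨hf⟩⟩ := h X.unop
  ⟨_, f.op, hN.op, ⟨normalEpiOfNormalMonoUnop f.op hf⟩⟩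

theorem IsNormalGenerator.hom_ext {M : C} (hM : IsNormalGenerator M) {X Y : C} {f f' : X ⟶ Y}
    (h : ∀ x : M ⟶ X, x ≫ f = x ≫ f') : f = f' := by
  obtain ⟨N, g, ⟨n, a, b, hab⟩, ⟨hg⟩⟩ := hM X
  have : Epi g := epi_of_isColimit_cofork hg.isColimit
  rw [← cancel_epi g, ← Category.id_comp (g ≫ f), ← Category.id_comp (g ≫ f'), ← hab]
  simp only [Preadditive.sum_comp, Category.assoc]
  refine Finset.sum_congr rfl fun i _ => ?_
  have := h (b i ≫ g)
  rw [Category.assoc, Category.assoc] at this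
  rw [this]

theorem IsNormalCogenerator.hom_ext {M : C} (hM : IsNormalCogenerator M) {X Y : C} {f f' : X ⟶ Y}
    (h : ∀ x : Y ⟶ M, f ≫ x = f' ≫ x) : f = f' :=
  Quiver.Hom.op_inj (hM.op.hom_ext fun x => Quiver.Hom.unop_inj (h x.unop))

/-- A generator for the cokernels is fully faithful, if cokernels are stable under pullbacks. -/
theorem IsNormalGenerator.existsUnique_comp [HasPullbacks C]
    (hC : (cokernelMorphisms C).IsStableUnderBaseChange) {M : C} (hM : IsNormalGenerator M)
    {X Y : C} (φ : (M ⟶ X) →+ (M ⟶ Y)) (hφ : ∀ (a : M ⟶ M) (x : M ⟶ X), φ (a ≫ x) = a ≫ φ x) :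
    ∃! f : X ⟶ Y, ∀ x, φ x = x ≫ f := by
  refine existsUnique_of_exists_of_unique ?_ fun f f' hf hf' =>
    hM.hom_ext fun x => (hf x).symm.trans (hf' x)
  obtain ⟨N, g, ⟨n, a, b, hab⟩, ⟨hg⟩⟩ := hM X
  -- The only candidate for `g ≫ f`, dictated by the decomposition of `𝟙 N` through copies of `M`.
  let ψ : N ⟶ Y := ∑ i, a i ≫ φ (b i ≫ g)
  have hψ : ∀ c : M ⟶ N, c ≫ ψ = φ (c ≫ g) := fun c => by
    rw [← Category.id_comp g, ← hab]
    simp only [ψ, Preadditive.comp_sum, Preadditive.sum_comp, Category.assoc, map_sum]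
    refine Finset.sum_congr rfl fun i _ => ?_
    rw [← Category.assoc c (a i), ← Category.assoc c (a i), hφ]
  have hW : hg.g ≫ ψ = 0 := hM.hom_ext fun c => by
    rw [← Category.assoc, hψ, Category.assoc, hg.w, comp_zero, comp_zero, map_zero]
  let f : X ⟶ Y := hg.isColimit.desc (CokernelCofork.ofπ ψ hW)
  have hf : g ≫ f = ψ := hg.isColimit.fac (CokernelCofork.ofπ ψ hW) WalkingParallelPair.one
  refine ⟨f, fun x => ?_⟩
  -- A map `x` from `M` need not lift through `g`; it does after pulling `g` back along `x`, and the
  -- pullback is still epi.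
  obtain ⟨hp⟩ : Nonempty (NormalEpi (pullback.snd g x)) :=
    hC.of_isPullback (IsPullback.of_hasPullback g x) ⟨hg⟩
  have : Epi (pullback.snd g x) := epi_of_isColimit_cofork hp.isColimit
  rw [← cancel_epi (pullback.snd g x)]
  refine hM.hom_ext fun c => ?_
  rw [← Category.assoc, ← hφ, Category.assoc, ← pullback.condition, ← Category.assoc, ← hψ, ← hf,
    Category.assoc, pullback.condition_assoc]

end Generator

/-! ### Self-duality of quasi-abelian categories -/

section QuasiAbelian

variable {C : Type u} [Category.{v} C] [Preadditive C]

theorem hasFiniteBiproducts_op [HasFiniteBiproducts C] : HasFiniteBiproducts Cᵒᵖ :=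
  HasFiniteBiproducts.of_hasFiniteProducts

instance [IsQuasiAbelian C] : HasEqualizers C := Preadditive.hasEqualizers_of_hasKernels

instance [IsQuasiAbelian C] : HasCoequalizers C := Preadditive.hasCoequalizers_of_hasCokernels

instance [IsQuasiAbelian C] : HasPullbacks C :=
  hasPullbacks_of_hasBinaryProducts_of_hasEqualizers C

instance [IsQuasiAbelian C] : HasPushouts C :=
  hasPushouts_of_hasBinaryCoproducts_of_hasCoequalizers C

instance isQuasiAbelian_op [IsQuasiAbelian C] : IsQuasiAbelian Cᵒᵖ where
  toHasFiniteBiproducts := hasFiniteBiproducts_op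
  has_limit f := inferInstance
  has_colimit f := inferInstance
  kernels_pushout :=
    { of_isPushout := by
        rintro _ _ _ _ _ _ _ _ sq ⟨h⟩
        obtain ⟨h'⟩ := IsQuasiAbelian.cokernels_pullback.of_isPullback sq.unop
          ⟨⟨_, h.g.unop, _, KernelFork.IsLimit.ofιUnop _ _ h.isLimit⟩⟩
        exact ⟨normalMonoOfNormalEpiUnop _ h'⟩ }
  cokernels_pullback :=
    { of_isPullback := by
        rintro _ _ _ _ _ _ _ _ sq ⟨h⟩
        obtain ⟨h'⟩ := IsQuasiAbelian.kernels_pushout.of_isPushout sq.unop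
          ⟨⟨_, h.g.unop, _, CokernelCofork.IsColimit.ofπUnop _ _ h.isColimit⟩⟩
        exact ⟨normalEpiOfNormalMonoUnop _ h'⟩ }

variable [IsQuasiAbelian C]

theorem isSummand_of_memAdd {M N : C} (h : MemAdd M N) : IsSummand M N := by
  obtain ⟨n, N', ⟨e⟩⟩ := h
  have : HasBinaryBiproducts C := hasBinaryBiproducts_of_finite_biproducts C
  refine ⟨n, fun i => biprod.inl ≫ e.hom ≫ biproduct.π (fun _ => M) i,
    fun i => biproduct.ι (fun _ => M) i ≫ e.inv ≫ biprod.fst, ?_⟩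
  have h1 := biproduct.total (f := fun _ : Fin n => M)
  calc _ = biprod.inl ≫ e.hom ≫
        (∑ i, biproduct.π (fun _ : Fin n => M) i ≫ biproduct.ι (fun _ => M) i) ≫
          e.inv ≫ biprod.fst := by
        simp only [Preadditive.comp_sum, Preadditive.sum_comp, Category.assoc]
    _ = 𝟙 N := by rw [h1]; simp

theorem isNormalGenerator {M : C} (hM : IsGenerator M) : IsNormalGenerator M := fun X =>
  let ⟨N, g, hN, _, _, zero, _, ⟨h⟩⟩ := hM X
  ⟨N, g, isSummand_of_memAdd hN, ⟨⟨_, _, zero, h⟩⟩⟩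

theorem isNormalCogenerator {M : C} (hM : IsCogenerator M) : IsNormalCogenerator M := fun X =>
  let ⟨N, f, hN, _, _, zero, ⟨h⟩, _⟩ := hM X
  ⟨N, f, isSummand_of_memAdd hN, ⟨⟨_, _, zero, h⟩⟩⟩

theorem IsNormalCogenerator.existsUnique_comp {M : C} (hM : IsNormalCogenerator M)
    {X Y : C} (φ : (X ⟶ M) →+ (Y ⟶ M)) (hφ : ∀ (x : X ⟶ M) (a : M ⟶ M), φ (x ≫ a) = φ x ≫ a) :
    ∃! f : Y ⟶ X, ∀ x, φ x = f ≫ x := by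
  obtain ⟨f, hf, huniq⟩ := hM.op.existsUnique_comp IsQuasiAbelian.cokernels_pullback
    (X := Opposite.op X) (Y := Opposite.op Y)
    (AddMonoidHom.mk' (fun x => (φ x.unop).op) fun x y => by simp)
    fun a x => Quiver.Hom.unop_inj (hφ x.unop a.unop)
  exact ⟨f.unop, fun x => Quiver.Hom.op_inj (hf x.op),
    fun g hg => Quiver.Hom.op_inj (huniq g.op fun x => Quiver.Hom.unop_inj (hg x.unop))⟩

end QuasiAbelian

/-! ### The dense family of left ideals of the endomorphism ring -/

section DenseFamily

variable {C : Type u} [Category.{v} C] [Preadditive C] {M : C} {R : Type v} [Ring R]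
  (e : R ≃+ (M ⟶ M)) (he : ∀ a b, e (a * b) = e b ≫ e a)

include he in
theorem symm_comp (f g : M ⟶ M) : e.symm (f ≫ g) = e.symm g * e.symm f :=
  e.injective (by simp [he])

/-- The left ideal of endomorphisms of `M` that factor through `j`, for a ring `R` of endomorphisms
of `M`. -/
def factorIdeal {Q : C} (j : M ⟶ Q) : Ideal R where
  carrier := {x | ∃ h : Q ⟶ M, e x = j ≫ h}
  add_mem' := fun ⟨h, hh⟩ ⟨h', hh'⟩ => ⟨h + h', by rw [map_add, hh, hh', Preadditive.comp_add]⟩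
  zero_mem' := ⟨0, by simp⟩
  smul_mem' := fun a x ⟨h, hh⟩ => ⟨h ≫ e a, by rw [smul_eq_mul, he, hh, Category.assoc]⟩

theorem symm_mem_factorIdeal {Q : C} (j : M ⟶ Q) (h : Q ⟶ M) :
    e.symm (j ≫ h) ∈ factorIdeal e he j := ⟨h, by simp⟩

variable [IsQuasiAbelian C]

/-- Composing `φ` with `h ↦ j ≫ h` gives a linear map from `Hom(Q, M)` to `Hom(M, M)`, so it is
precomposition with some `g : M ⟶ Q`. Since `g` is killed by the morphism of which `j` is the
kernel, it factors as `t ≫ j`. -/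
theorem existsUnique_mul_factorIdeal (hM : IsNormalCogenerator M) {Q : C} {j : M ⟶ Q}
    (hj : NormalMono j) (φ : factorIdeal e he j →ₗ[R] R) :
    ∃! t, ∀ x : factorIdeal e he j, φ x = x * t := by
  have : Mono j := mono_of_isLimit_fork hj.isLimit
  let s : (Q ⟶ M) →+ factorIdeal e he j := AddMonoidHom.mk'
    (fun h => ⟨e.symm (j ≫ h), symm_mem_factorIdeal e he j h⟩) fun h h' => by
      ext
      simp
  obtain ⟨g, hg, -⟩ := hM.existsUnique_comp
    (e.toAddMonoidHom.comp (φ.toAddMonoidHom.comp s)) fun h a => by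
      have : s (h ≫ a) = e.symm a • s h := by
        ext
        simp [s, ← symm_comp e he]
      simp [this, he]
  have hg' : ∀ h, e (φ (s h)) = g ≫ h := hg
  have hzero : g ≫ hj.g = 0 := hM.hom_ext fun h => by
    have : s (hj.g ≫ h) = 0 := by
      ext
      simp [s, reassoc_of% hj.w]
    rw [Category.assoc, ← hg', this]
    simp
  obtain ⟨t, ht⟩ := KernelFork.IsLimit.lift' hj.isLimit g hzero
  replace ht : t ≫ j = g := ht
  refine ⟨e.symm t, fun x => ?_, fun t' ht' => e.injective ?_⟩
  · obtain ⟨h, hh⟩ := x.2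
    have hx : x = s h := by
      ext
      simp [s, ← hh]
    apply e.injective
    rw [he, hx, hg', ← ht]
    simp [s]
  · rw [e.apply_symm_apply, ← cancel_mono j]
    refine hM.hom_ext fun h => ?_
    rw [ht, ← hg', ht', he]
    simp [s]

/-- With `r` read as a map `m` between powers of `M`, `Hom(M, kernel m)` is the image of `T`. Hence
`T u ↦ w u` is well defined and comes from some `a : kernel m ⟶ M`. The required `j` is the pushout
of the kernel inclusion along `a`. -/
theorem exists_mul_mem_factorIdeal (hM : IsNormalGenerator M) {I J L : Type} [Fintype I]
    [Fintype J] [Fintype L] (r : Matrix I J R) (T : Matrix J L R)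
    (hr : ∀ v, r.mulVec v = 0 ↔ ∃ u, T.mulVec u = v) (w : L → R)
    (hw : ∀ u, T.mulVec u = 0 → ∑ l, w l * u l = 0) :
    ∃ (Q : C) (j : M ⟶ Q), Nonempty (NormalMono j) ∧
      ∀ x ∈ factorIdeal e he j, ∃ y : J → R, ∀ l, x * w l = ∑ j, y j * T j l := by
  let m : (⨁ fun _ : J => M) ⟶ ⨁ fun _ : I => M :=
    biproduct.lift fun i => biproduct.desc fun j => e (r i j)
  have hdesc : ∀ v w : J → R, biproduct.lift (fun j => e (v j)) ≫
      biproduct.desc (fun j => e (w j)) = e (∑ j, w j * v j) := fun v w => by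
    simp [biproduct.lift_desc, he]
  have hm : ∀ v : J → R, biproduct.lift (fun j => e (v j)) ≫ m = 0 ↔ r.mulVec v = 0 := by
    intro v
    have h : ∀ i, (biproduct.lift (fun j => e (v j)) ≫ m) ≫ biproduct.π _ i =
        e (r.mulVec v i) := fun i => by
      rw [Category.assoc, biproduct.lift_π, hdesc]
      rfl
    refine ⟨fun h0 => ?_, fun h0 => ?_⟩
    · ext i
      apply e.injective
      rw [← h, h0]
      simp
    · ext i
      rw [h, h0]
      simp
  let vec : (M ⟶ kernel m) → J → R := fun x j => e.symm (x ≫ kernel.ι m ≫ biproduct.π _ j)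
  have hvec : ∀ x, x ≫ kernel.ι m = biproduct.lift fun j => e (vec x j) := fun x => by
    ext j
    simp [vec]
  have hvec' : ∀ x, r.mulVec (vec x) = 0 := fun x => by
    rw [← hm, ← hvec, Category.assoc, kernel.condition, comp_zero]
  choose u hu using fun x => (hr _).1 (hvec' x)
  have hwell : ∀ u u' : L → R, T.mulVec u = T.mulVec u' → ∑ l, w l * u l = ∑ l, w l * u' l := by
    intro u u' h
    rw [← sub_eq_zero, ← Finset.sum_sub_distrib,
      ← hw (u - u') (by rw [Matrix.mulVec_sub, h, sub_self])]
    simp [mul_sub]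
  obtain ⟨a, ha, -⟩ := hM.existsUnique_comp IsQuasiAbelian.cokernels_pullback
    (AddMonoidHom.mk' (fun x => e (∑ l, w l * u x l)) fun x y => by
      rw [← map_add, ← Finset.sum_add_distrib, hwell (u (x + y)) (u x + u y)]
      · simp [mul_add]
      · rw [Matrix.mulVec_add, hu, hu, hu]
        ext j
        simp [vec]) fun c x => by
      change e (∑ l, w l * u (c ≫ x) l) = c ≫ e (∑ l, w l * u x l)
      rw [hwell (u (c ≫ x)) (MulOpposite.op (e.symm c) • u x)]
      · apply e.symm.injective
        rw [symm_comp e he]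
        simp [Finset.sum_mul, mul_assoc]
      · rw [Matrix.mulVec_smul, hu, hu]
        ext j
        simp [vec, symm_comp e he]
  replace ha : ∀ x, e (∑ l, w l * u x l) = x ≫ a := ha
  refine ⟨pushout a (kernel.ι m), pushout.inl _ _,
    IsQuasiAbelian.kernels_pushout.of_isPushout (IsPushout.of_hasPushout a (kernel.ι m))
      ⟨⟨_, m, kernel.condition m, kernelIsKernel m⟩⟩, ?_⟩
  rintro x ⟨h, hx⟩
  -- The `y j` are the components of the map from the power of `M` supplied by the other leg of the
  -- pushout.
  refine ⟨fun j => e.symm (biproduct.ι (fun _ => M) j ≫ pushout.inr a (kernel.ι m) ≫ h), fun l => ?_⟩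
  classical
  -- Column `l` of `T`, as a map into the kernel; `a` sends it to `w l`.
  let z : M ⟶ kernel m := kernel.lift m (biproduct.lift fun j => e (T j l)) ((hm _).2
    ((hr _).2 ⟨Pi.single l 1, by ext; simp⟩))
  have hz : z ≫ a = e (w l) := by
    rw [← ha, hwell (u z) (Pi.single l 1)]
    · simp [Pi.single_apply]
    · rw [hu]
      ext j
      simp [vec, z]
  apply e.injective
  rw [he, hx, ← hz, Category.assoc, pushout.condition_assoc, ← hdesc, kernel.lift_ι_assoc]
  congr 1
  ext j
  simp

theorem isDenseFamily_factorIdeal (hM : IsNormalGenerator M) (hM' : IsNormalCogenerator M) :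
    IsDenseFamily {𝔞 | ∃ (Q : C) (j : M ⟶ Q), Nonempty (NormalMono j) ∧ 𝔞 = factorIdeal e he j} where
  colon := by
    rintro _ ⟨Q, j, hj, rfl⟩ a
    -- Pushing `j` out along `a` works: if `x` factors through the new kernel, the pushout square
    -- makes `x * a` factor through `j`.
    refine ⟨_, ⟨pushout (e a) j, pushout.inl _ _,
      IsQuasiAbelian.kernels_pushout.of_isPushout (IsPushout.of_hasPushout (e a) j) hj, rfl⟩, ?_⟩
    rintro x ⟨h, hx⟩
    exact ⟨pushout.inr _ _ ≫ h, by rw [he, hx, pushout.condition_assoc]⟩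
  existsUnique_mul := by
    rintro _ ⟨Q, j, ⟨hj⟩, rfl⟩ φ
    exact existsUnique_mul_factorIdeal e he hM' hj φ
  exists_mul_mem r T hr w hw := by
    obtain ⟨Q, j, hj, h⟩ := exists_mul_mem_factorIdeal e he hM r T hr w hw
    exact ⟨_, ⟨Q, j, hj, rfl⟩, h⟩

/-- The abstract identification `e` lets the same argument apply to `M` in `C` and to `op M` in
`Cᵒᵖ`, whose endomorphisms are identified with `(End M)ᵐᵒᵖ`. -/
theorem satisfiesTwoSidedCondition_end (hM : IsGeneratorCogenerator M)
    [IsNoetherianRing (End M)] [IsNoetherianRing (End M)ᵐᵒᵖ] :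
    SatisfiesTwoSidedCondition (End M) 2 2 := by
  have h1 := isNormalGenerator hM.1
  have h2 := isNormalCogenerator hM.2
  have : IsNoetherianRing (End M)ᵐᵒᵖᵐᵒᵖ :=
    isNoetherianRing_of_ringEquiv (End M) (RingEquiv.opOp (End M))
  exact ⟨satisfiesCondition_of_isDenseFamily
      (isDenseFamily_factorIdeal (R := End M) (AddEquiv.refl _) (fun _ _ => rfl) h1 h2),
    satisfiesCondition_of_isDenseFamily
      (isDenseFamily_factorIdeal (R := (End M)ᵐᵒᵖ) (M := Opposite.op M)
        { toFun := fun x => Quiver.Hom.op x.unop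
          invFun := fun f => MulOpposite.op f.unop
          left_inv := fun _ => rfl
          right_inv := fun _ => rfl
          map_add' := fun _ _ => rfl } (fun _ _ => rfl) h2.op h1.op)⟩

end DenseFamily

/-! ### Reflexive modules and the functor `Hom(M, -)` -/

section Presentation

variable {S : Type u} [Ring S] [IsNoetherianRing Sᵐᵒᵖ] {Y : Type w} [AddCommGroup Y] [Module S Y]

/-- Evaluation at generators of `Y` embeds the dual in a Noetherian module. -/
theorem dual_finite [Module.Finite S Y] : Module.Finite Sᵐᵒᵖ (Y →ₗ[S] S) := by
  obtain ⟨n, f, hf⟩ := Module.Finite.exists_fin' S Y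
  let r : (Y →ₗ[S] S) →ₗ[Sᵐᵒᵖ] (Fin n → S) :=
    { toFun := fun g i => g (f (Pi.single i 1))
      map_add' := fun _ _ => rfl
      map_smul' := fun _ _ => rfl }
  refine Module.Finite.of_injective r fun g g' h => ?_
  ext y
  obtain ⟨c, rfl⟩ := hf y
  rw [pi_eq_sum_univ' c]
  simp only [map_sum, map_smul]
  exact Finset.sum_congr rfl fun i _ => congrArg _ (congrFun h i)

/-- A reflexive module over a ring Noetherian on the other side is the kernel of a map between free
modules of finite rank. -/
theorem exists_linearMap_of_isReflexiveModule (hY : IsReflexiveModule S Y) :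
    ∃ (n k : ℕ) (f : Y →ₗ[S] (Fin n → S)) (c : Matrix (Fin n) (Fin k) S), Function.Injective f ∧
      ∀ v, (∃ y, f y = v) ↔ Matrix.vecMul v c = 0 := by
  obtain ⟨hfin, hinj, hsurj⟩ := hY
  have := dual_finite (S := S) (Y := Y)
  obtain ⟨n, g, hg⟩ := Module.Finite.exists_fin (R := Sᵐᵒᵖ) (M := Y →ₗ[S] S)
  let q : (Fin n → S) →ₗ[Sᵐᵒᵖ] (Y →ₗ[S] S) :=
    { toFun := fun s => ∑ j, MulOpposite.op (s j) • g j
      map_add' := fun s t => by simp [add_smul, Finset.sum_add_distrib]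
      map_smul' := fun a s => by simp [Finset.smul_sum, mul_smul] }
  have hq : ∀ s y, q s y = ∑ j, g j y * s j := fun s y => by simp [q]
  -- Thus `c` and `q` present the dual of `Y`; dualizing yields the sequence `0 → Y → Sⁿ → Sᵏ`.
  obtain ⟨k, c, hc⟩ := exists_matrix_of_submodule (LinearMap.ker q)
  let f : Y →ₗ[S] (Fin n → S) := LinearMap.pi g
  have hsurj' : ∀ φ, ∃ s, q s = φ := fun φ => by
    have hφ : φ ∈ Submodule.span Sᵐᵒᵖ (Set.range g) := hg ▸ Submodule.mem_top
    obtain ⟨d, hd⟩ := Submodule.mem_span_range_iff_exists_fun (R := Sᵐᵒᵖ) |>.1 hφ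
    exact ⟨fun j => (d j).unop, hd⟩
  refine ⟨n, k, f, c, fun y y' h => hinj (LinearMap.ext fun φ => ?_), fun v => ⟨?_, fun hv => ?_⟩⟩
  · obtain ⟨s, rfl⟩ := hsurj' φ
    change q s y = q s y'
    rw [hq, hq]
    exact Finset.sum_congr rfl fun j _ => congrArg (· * s j) (congrFun h j)
  · rintro ⟨y, rfl⟩
    classical
    ext i
    have hi : q (fun j => c j i) = 0 := (hc _).2 ⟨Pi.single i 1, by ext; simp⟩
    exact (hq _ y).symm.trans (by rw [hi]; rfl)
  -- Because `v c = 0`, pairing with `v` descends along `q` to a functional on the dual of `Y`;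
  -- reflexivity makes it evaluation at some `y`.
  · have hwell : ∀ s t, q s = q t → v ⬝ᵥ s = v ⬝ᵥ t := fun s t h => by
      obtain ⟨u, hu⟩ := (hc (s - t)).1 (by rw [LinearMap.mem_ker, map_sub, h, sub_self])
      rw [← sub_eq_zero, ← dotProduct_sub, ← hu, Matrix.dotProduct_mulVec, hv, zero_dotProduct]
    choose s hs using hsurj'
    obtain ⟨y, hy⟩ := hsurj
      { toFun := fun φ => v ⬝ᵥ s φ
        map_add' := fun φ ψ => by
          rw [← dotProduct_add]
          exact hwell _ _ (by rw [map_add, hs, hs, hs])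
        map_smul' := fun a φ => by
          rw [RingHom.id_apply, ← dotProduct_smul]
          exact hwell _ _ (by rw [map_smul, hs, hs]) }
    refine ⟨y, ?_⟩
    classical
    ext j
    refine (LinearMap.congr_fun hy (g j)).trans ((hwell _ (Pi.single j 1) ?_).trans (by simp))
    rw [hs]
    ext y
    simp [hq, Pi.single_apply]

end Presentation

section HomFunctor

variable {C : Type u} [Category.{v} C] [Preadditive C] {M : C}

variable (M) in
/-- The identity, as a map from endomorphisms to the opposite of the endomorphism ring. -/
def opEnd : (M ⟶ M) ≃+ (End M)ᵐᵒᵖ := MulOpposite.opAddEquiv (α := End M)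

/-- Postcomposition with `g`, as an element of the dual of `Hom(M, X)`. -/
def dualOfHom {X : C} (g : X ⟶ M) : (M ⟶ X) →ₗ[(End M)ᵐᵒᵖ] (End M)ᵐᵒᵖ where
  toFun x := MulOpposite.op (x ≫ g)
  map_add' x y := congrArg MulOpposite.op (Preadditive.add_comp _ _ _ x y g)
  map_smul' a x := congrArg MulOpposite.op (Category.assoc a.unop x g)

/-- A monomorphism from `X` to a summand of a power of `M` embeds `Hom(M, X)` in a free module of
finite rank. -/
theorem finite_hom (hM : IsNormalCogenerator M) [IsNoetherianRing (End M)ᵐᵒᵖ] (X : C) :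
    Module.Finite (End M)ᵐᵒᵖ (M ⟶ X) := by
  obtain ⟨N, i, ⟨n, a, b, hab⟩, ⟨hi⟩⟩ := hM X
  have : Mono i := mono_of_isLimit_fork hi.isLimit
  let r : (M ⟶ X) →ₗ[(End M)ᵐᵒᵖ] (Fin n → (End M)ᵐᵒᵖ) :=
    LinearMap.pi fun k => dualOfHom (i ≫ a k)
  refine Module.Finite.of_injective r fun x y h => ?_
  rw [← cancel_mono i, ← Category.comp_id (x ≫ i), ← Category.comp_id (y ≫ i), ← hab,
    Preadditive.comp_sum, Preadditive.comp_sum]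
  refine Finset.sum_congr rfl fun k _ => ?_
  have hk : x ≫ i ≫ a k = y ≫ i ≫ a k := congrArg MulOpposite.unop (congrFun h k)
  simp only [Category.assoc, reassoc_of% hk]

theorem preadditiveCoyonedaObj_faithful (hM : IsNormalGenerator M) :
    (preadditiveCoyonedaObj M).Faithful where
  map_injective h := hM.hom_ext fun x =>
    LinearMap.congr_fun (congrArg ModuleCat.Hom.hom h) x

variable [IsQuasiAbelian C]

theorem dual_hom_eq_comp (hM : IsNormalGenerator M) {X : C}
    (f : (M ⟶ X) →ₗ[(End M)ᵐᵒᵖ] (End M)ᵐᵒᵖ) :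
    ∃! g : X ⟶ M, ∀ x, (f x).unop = x ≫ g :=
  hM.existsUnique_comp IsQuasiAbelian.cokernels_pullback
    (AddMonoidHom.mk' (fun x => ((f x).unop : M ⟶ M)) fun x y => by rw [map_add]; rfl)
    fun a x => congrArg MulOpposite.unop (f.map_smul (MulOpposite.op a) x)

/-- The generator property identifies the dual with `Hom(X, M)`; the cogenerator property then makes
every functional on it evaluation at a unique `x : M ⟶ X`. -/
theorem isReflexiveModule_hom (hM : IsNormalGenerator M) (hM' : IsNormalCogenerator M)
    [IsNoetherianRing (End M)ᵐᵒᵖ] (X : C) : IsReflexiveModule (End M)ᵐᵒᵖ (M ⟶ X) := by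
  refine ⟨finite_hom hM' X, fun x y h => ?_, fun Φ => ?_⟩
  · exact hM'.hom_ext fun g =>
      congrArg MulOpposite.unop (DFunLike.congr_fun h (dualOfHom g))
  · obtain ⟨x, hx, -⟩ := hM'.existsUnique_comp (X := X) (Y := M)
      (AddMonoidHom.mk' (fun g => ((Φ (dualOfHom g)).unop : M ⟶ M)) fun g g' => by
        have : dualOfHom (g + g') = dualOfHom g + dualOfHom g' := by
          ext y
          exact congrArg MulOpposite.op (Preadditive.comp_add _ _ _ y g g')
        rw [this, map_add]
        rfl) fun g a => by
        have : dualOfHom (g ≫ a) =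
            MulOpposite.op (MulOpposite.op (show End M from a)) • dualOfHom g := by
          ext y
          exact congrArg MulOpposite.op (Category.assoc y g a).symm
        change (Φ (dualOfHom (g ≫ a))).unop = _
        rw [this, map_smul]
        rfl
    refine ⟨x, ?_⟩
    ext f
    obtain ⟨g, hg, -⟩ := dual_hom_eq_comp hM f
    have : f = dualOfHom g := by
      ext y
      exact congrArg MulOpposite.op (hg y)
    subst this
    exact congrArg MulOpposite.op (hx g).symm

theorem preadditiveCoyonedaObj_full (hM : IsNormalGenerator M) :
    (preadditiveCoyonedaObj M).Full where
  map_surjective {X Y} φ := by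
    obtain ⟨f, hf, -⟩ := hM.existsUnique_comp IsQuasiAbelian.cokernels_pullback
      (X := X) (Y := Y) φ.hom.toAddMonoidHom
      fun a x => φ.hom.map_smul (MulOpposite.op a) x
    exact ⟨f, ModuleCat.hom_ext (LinearMap.ext fun x => (hf x).symm)⟩

/-- `Hom(M, -)` preserves kernels and turns matrices between powers of `M` into matrices over the
ring, so the kernel presentation of `Y` can be realized in `C`. -/
theorem exists_linearEquiv_hom [IsNoetherianRing (End M)] {Y : Type w}
    [AddCommGroup Y] [Module (End M)ᵐᵒᵖ Y] (hY : IsReflexiveModule (End M)ᵐᵒᵖ Y) :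
    ∃ X : C, Nonempty ((M ⟶ X) ≃ₗ[(End M)ᵐᵒᵖ] Y) := by
  have : IsNoetherianRing (End M)ᵐᵒᵖᵐᵒᵖ :=
    isNoetherianRing_of_ringEquiv (End M) (RingEquiv.opOp (End M))
  obtain ⟨n, k, f, c, hf, hc⟩ := exists_linearMap_of_isReflexiveModule hY
  let m : (⨁ fun _ : Fin n => M) ⟶ ⨁ fun _ : Fin k => M :=
    biproduct.lift fun i => biproduct.desc fun j => (c j i).unop
  let g : (M ⟶ kernel m) →ₗ[(End M)ᵐᵒᵖ] (Fin n → (End M)ᵐᵒᵖ) :=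
    LinearMap.pi fun j => dualOfHom (kernel.ι m ≫ biproduct.π (fun _ => M) j)
  have hm : ∀ (v : M ⟶ (⨁ fun _ : Fin n => M)) (w : Fin n → (End M)ᵐᵒᵖ),
      (∀ j, opEnd M (v ≫ biproduct.π (fun _ => M) j) = w j) →
        (v ≫ m = 0 ↔ Matrix.vecMul w c = 0) := by
    intro v w hw
    have h : ∀ i, opEnd M ((v ≫ m) ≫ biproduct.π (fun _ => M) i) = Matrix.vecMul w c i :=
      fun i => by
        rw [Category.assoc, biproduct.lift_π, biproduct.desc_eq, Preadditive.comp_sum, map_sum]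
        refine Finset.sum_congr rfl fun j _ => ?_
        rw [← hw, ← Category.assoc]
        rfl
    refine ⟨fun h0 => ?_, fun h0 => ?_⟩
    · ext i
      rw [← h, h0, zero_comp, map_zero, Pi.zero_apply]
    · ext i
      apply (opEnd M).injective
      rw [h, h0, zero_comp, map_zero, Pi.zero_apply]
  have hg : Function.Injective g := fun x y h => by
    rw [← cancel_mono (kernel.ι m)]
    ext j
    rw [Category.assoc, Category.assoc]
    exact congrArg MulOpposite.unop (congrFun h j)
  have hrange : LinearMap.range g = LinearMap.range f := by
    ext v
    rw [LinearMap.mem_range, LinearMap.mem_range, hc]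
    refine ⟨?_, fun h => ?_⟩
    · rintro ⟨x, rfl⟩
      rw [← hm (x ≫ kernel.ι m) (g x) fun j => congrArg (opEnd M) (Category.assoc _ _ _),
        Category.assoc, kernel.condition, comp_zero]
    · let x : M ⟶ ⨁ fun _ : Fin n => M := biproduct.lift fun j => (opEnd M).symm (v j)
      have hx : ∀ j, opEnd M (x ≫ biproduct.π (fun _ => M) j) = v j := fun j => by simp [x]
      refine ⟨kernel.lift m x ((hm x v hx).2 h), ?_⟩
      ext j
      refine Eq.trans (congrArg (opEnd M) ?_) (hx j)
      rw [← Category.assoc, kernel.lift_ι]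
  exact ⟨kernel m, ⟨(LinearEquiv.ofInjective g hg).trans
    ((LinearEquiv.ofEq _ _ hrange).trans (LinearEquiv.ofInjective f hf).symm)⟩⟩

end HomFunctor

end

end ReflMorita

theorem mainTheorem2 {C : Type u} [Category.{v} C] [Preadditive C]
    [ReflMorita.IsQuasiAbelian C] (M : C) (hM : ReflMorita.IsGeneratorCogenerator M)
    (hleft : IsNoetherianRing (End M)) (hright : IsNoetherianRing (End M)ᵐᵒᵖ) :
    ReflMorita.SatisfiesTwoSidedCondition (End M) 2 2 ∧
      ∃ h : ∀ X : C, ReflMorita.reflexiveModules (End M)ᵐᵒᵖ ((preadditiveCoyonedaObj M).obj X),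
        ((ReflMorita.reflexiveModules (End M)ᵐᵒᵖ).lift
          (preadditiveCoyonedaObj M) h).IsEquivalence := by
  have h1 := ReflMorita.isNormalGenerator hM.1
  have h2 := ReflMorita.isNormalCogenerator hM.2
  refine ⟨ReflMorita.satisfiesTwoSidedCondition_end hM,
    ReflMorita.isReflexiveModule_hom h1 h2, ?_⟩
  have := ReflMorita.preadditiveCoyonedaObj_faithful h1
  have := ReflMorita.preadditiveCoyonedaObj_full h1
  refine { faithful := Functor.Faithful.of_comp_iso
             (ObjectProperty.liftCompιIso _ (preadditiveCoyonedaObj M) _)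
           full := Functor.Full.of_comp_faithful_iso
             (ObjectProperty.liftCompιIso _ (preadditiveCoyonedaObj M) _)
           essSurj := ⟨fun Y => ?_⟩ }
  obtain ⟨X, ⟨e⟩⟩ := ReflMorita.exists_linearEquiv_hom (M := M) Y.property
  exact ⟨X, ⟨(ReflMorita.reflexiveModules (End M)ᵐᵒᵖ).isoMk e.toModuleIso⟩⟩
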